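/- Let $\mathbf{k}$ be a field, $n\ge 0$ an integer and $\hat O=\mathbf{k}[[x_1,\dots,x_n]]$. Let $U_{loc}=\{u\in\mathbb{R}^n \mid u_i\le 0 \text{ for all } i\}$. For $u\in U_{loc}$ and $0\ne f=\sum_\alpha c_\alpha x^\alpha\in\hat O$, let $\mathrm{ord}^u(f)=\max\{u\cdot\alpha \mid c_\alpha\ne 0\}$ (this maximum exists) and let the initial form $\mathrm{in}_u(f)=\sum_{u\cdot\alpha=\mathrm{ord}^u(f)}c_\alpha x^\alpha$ be the sum of the terms of $f$ of maximal weight; put $\mathrm{in}_u(0)=0$. Let $\mathrm{gr}^u(\hat O)=\bigoplus_k F^u_k/F^u_{<k}$ be the graded ring associated with the filtration $F^u_k=\{f \mid f=0 \text{ or } \mathrm{ord}^u(f)\le k\}$, $k\in\mathbb{R}$; identifying each class in $F^u_k/F^u_{<k}$ with its unique representative all of whose terms have weight $k$, regard it as the subring of $\hat O$ of those series in which only finitely many weights $u\cdot\alpha$ occur, i.e. $\mathbf{k}[[x_i : u_i=0]][x_i : u_i\neq 0]$. For an ideal $I\subset\hat O$ let $\mathrm{in}_u(I)$ be the ideal of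 $\mathrm{gr}^u(\hat O)$ generated by all $\mathrm{in}_u(f)$, $f\in I$. Theorem. For every ideal $I$ of $\hat O$, the set $\{\mathrm{in}_u(I) \mid u\in U_{loc}\}$ is finite. Here $\mathrm{in}_u(I)$ and $\mathrm{in}_{u'}(I)$ count as equal if and only if $\mathrm{gr}^u(\hat O)=\mathrm{gr}^{u'}(\hat O)$ as subrings of $\hat O$ and the two ideals of this ring coincide. -/

import Mathlib

/-! Weighted initial forms and initial ideals in `K[[x₁, …, xₙ]]`. -/

noncomputable section

namespace LocalGroebner

open scoped Classical

variable {K : Type*} [Field K] {n : ℕ}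

/-- The local weight vectors: all coordinates are nonpositive. -/
def Uloc (n : ℕ) : Set (Fin n → ℝ) := {u | ∀ i, u i ≤ 0}

/-- The weight `u · α` of an exponent `α`. -/
def weight (u : Fin n → ℝ) (α : Fin n →₀ ℕ) : ℝ := ∑ i, u i * (α i : ℝ)

/-- The support of a power series: the exponents with nonzero coefficient. -/
def supp (f : MvPowerSeries (Fin n) K) : Set (Fin n →₀ ℕ) :=
  {α | MvPowerSeries.coeff α f ≠ 0}

/-- The set of weights occurring in `f`. -/
def weights (u : Fin n → ℝ) (f : MvPowerSeries (Fin n) K) : Set ℝ := weight u '' supp f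

/-- The `u`-order of `f`: the maximum of `u · α` over the support of `f`.
For `f ≠ 0` and `u` local this maximum is attained, see `isGreatest_ord`. -/
def ord (u : Fin n → ℝ) (f : MvPowerSeries (Fin n) K) : ℝ := sSup (weights u f)

/-- The part of `f` made of its terms of weight exactly `k`. -/
def component (u : Fin n → ℝ) (k : ℝ) (f : MvPowerSeries (Fin n) K) :
    MvPowerSeries (Fin n) K :=
  fun α => if weight u α = k then MvPowerSeries.coeff α f else 0

/-- The initial form of `f`: the sum of its terms of maximal weight. It is the canonical
representative of the class of `f` in `F_k / F_{<k}` where `k` is the `u`-order of `f`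
(see `existsUnique_homogeneous`); the initial form of `0` is `0`. -/
def initialForm (u : Fin n → ℝ) (f : MvPowerSeries (Fin n) K) : MvPowerSeries (Fin n) K :=
  component u (ord u f) f

/-- The step `F_k` of the filtration: the series whose `u`-order is at most `k`. -/
def filtLE (u : Fin n → ℝ) (k : ℝ) : Set (MvPowerSeries (Fin n) K) :=
  {f | ∀ α ∈ supp f, weight u α ≤ k}

/-- The step `F_{<k}` of the filtration: the series whose `u`-order is less than `k`. -/
def filtLT (u : Fin n → ℝ) (k : ℝ) : Set (MvPowerSeries (Fin n) K) :=
  {f | ∀ α ∈ supp f, weight u α < k}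

/-- The series all of whose terms have weight `k`. -/
def homogeneous (u : Fin n → ℝ) (k : ℝ) : Set (MvPowerSeries (Fin n) K) :=
  {f | ∀ α ∈ supp f, weight u α = k}

theorem weight_add (u : Fin n → ℝ) (α β : Fin n →₀ ℕ) :
    weight u (α + β) = weight u α + weight u β := by
  simp [weight, mul_add, Finset.sum_add_distrib]

theorem weight_zero (u : Fin n → ℝ) : weight u 0 = 0 := by simp [weight]

theorem coeff_component (u : Fin n → ℝ) (k : ℝ) (f : MvPowerSeries (Fin n) K)
    (α : Fin n →₀ ℕ) : MvPowerSeries.coeff α (component u k f) =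
      if weight u α = k then MvPowerSeries.coeff α f else 0 := rfl

theorem supp_nonempty {f : MvPowerSeries (Fin n) K} (hf : f ≠ 0) : (supp f).Nonempty := by
  by_contra h
  apply hf
  ext α
  by_contra hα
  exact h ⟨α, by simpa [supp] using hα⟩

/-- The maximum defining the `u`-order exists for a nonzero series and a local weight. -/
theorem isGreatest_ord {u : Fin n → ℝ} (hu : u ∈ Uloc n) {f : MvPowerSeries (Fin n) K}
    (hf : f ≠ 0) : IsGreatest (weights u f) (ord u f) := by
  have hmono : Monotone fun α : Fin n →₀ ℕ => -weight u α := by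
    intro α β h
    simp only [weight, neg_le_neg_iff]
    refine Finset.sum_le_sum fun i _ => ?_
    have h1 : (α i : ℝ) ≤ β i := by exact_mod_cast h i
    exact mul_le_mul_of_nonpos_left h1 (hu i)
  have hwf : ((fun α : Fin n →₀ ℕ => -weight u α) '' supp f).IsWF :=
    ((Set.isPWO_of_wellQuasiOrderedLE (supp f)).image_of_monotone hmono).isWF
  have hne := (supp_nonempty hf).image fun α : Fin n →₀ ℕ => -weight u α
  obtain ⟨α, hα, hα'⟩ := hwf.min_mem hne
  have hg : IsGreatest (weights u f) (weight u α) := by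
    refine ⟨⟨α, hα, rfl⟩, ?_⟩
    rintro _ ⟨β, hβ, rfl⟩
    have := hwf.min_le hne ⟨β, hβ, rfl⟩
    simp only at hα'
    linarith
  have : ord u f = weight u α := hg.csSup_eq
  rwa [this]

/-- Every class in `F_k / F_{<k}` contains exactly one series that is homogeneous of weight `k`,
namely the weight `k` component: so `F_k / F_{<k}` is identified with `homogeneous u k`. -/
theorem existsUnique_homogeneous (u : Fin n → ℝ) (k : ℝ) {f : MvPowerSeries (Fin n) K}
    (hf : f ∈ filtLE u k) :
    (component u k f ∈ homogeneous u k ∧ f - component u k f ∈ filtLT u k) ∧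
      ∀ g : MvPowerSeries (Fin n) K,
        g ∈ homogeneous u k → f - g ∈ filtLT u k → g = component u k f := by
  refine ⟨⟨?_, ?_⟩, ?_⟩
  · intro α hα
    by_contra h
    exact hα (by rw [coeff_component, if_neg h])
  · intro α hα
    simp only [supp, Set.mem_ofPred_eq, map_sub, coeff_component] at hα
    by_cases h : weight u α = k
    · simp [h] at hα
    · refine lt_of_le_of_ne (hf α ?_) h
      simpa [h, supp] using hα
  · intro g hg hfg
    ext α
    rw [coeff_component]
    split_ifs with h
    · by_contra hne
      have : α ∈ supp (f - g) := by
        simp only [supp, Set.mem_ofPred_eq, map_sub]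
        exact sub_ne_zero.mpr (Ne.symm hne)
      exact (hfg α this).ne h
    · by_contra hne
      exact h (hg α hne)

theorem weights_add_subset (u : Fin n → ℝ) (f g : MvPowerSeries (Fin n) K) :
    weights u (f + g) ⊆ weights u f ∪ weights u g := by
  rintro _ ⟨α, hα, rfl⟩
  by_cases h : α ∈ supp f
  · exact Or.inl ⟨α, h, rfl⟩
  · refine Or.inr ⟨α, fun h' => hα ?_, rfl⟩
    simp only [supp, Set.mem_ofPred_eq, not_not] at h
    rw [map_add, h, h', add_zero]

open scoped Pointwise in
theorem weights_mul_subset (u : Fin n → ℝ) (f g : MvPowerSeries (Fin n) K) :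
    weights u (f * g) ⊆ weights u f + weights u g := by
  rintro _ ⟨α, hα, rfl⟩
  simp only [supp, Set.mem_ofPred_eq, MvPowerSeries.coeff_mul] at hα
  obtain ⟨p, hp, hne⟩ := Finset.exists_ne_zero_of_sum_ne_zero hα
  rw [Finset.HasAntidiagonal.mem_antidiagonal] at hp
  rw [← hp, weight_add]
  exact Set.add_mem_add ⟨p.1, left_ne_zero_of_mul hne, rfl⟩ ⟨p.2, right_ne_zero_of_mul hne, rfl⟩

/-- The associated graded ring `gr^u(K[[x]]) = ⨁ₖ F_k / F_{<k}`, seen as a subring of `K[[x]]`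
through the canonical identification of `F_k / F_{<k}` with the series that are homogeneous of
weight `k`: its elements are the finite sums of homogeneous series, i.e. the series in which only
finitely many weights occur. For `u` local this is the ring `K[[xᵢ : uᵢ = 0]][xᵢ : uᵢ ≠ 0]`. -/
def gr (K : Type*) [Field K] (u : Fin n → ℝ) : Subalgebra K (MvPowerSeries (Fin n) K) where
  carrier := {f | (weights u f).Finite}
  mul_mem' {f g} hf hg := (Set.Finite.add hf hg).subset (weights_mul_subset u f g)
  add_mem' {f g} hf hg := (Set.Finite.union hf hg).subset (weights_add_subset u f g)
  algebraMap_mem' r := by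
    refine (Set.finite_singleton (0 : ℝ)).subset ?_
    rintro _ ⟨α, hα, rfl⟩
    simp only [supp, Set.mem_ofPred_eq, MvPowerSeries.algebraMap_apply, MvPowerSeries.coeff_C,
      Algebra.algebraMap_self, RingHom.id_apply] at hα
    have h0 : α = 0 := by
      by_contra h
      simp [h] at hα
    simp [h0, weight_zero]

theorem component_mem_gr (u : Fin n → ℝ) (k : ℝ) (f : MvPowerSeries (Fin n) K) :
    component u k f ∈ gr K u := by
  refine (Set.finite_singleton k).subset ?_
  rintro _ ⟨α, hα, rfl⟩
  by_contra h
  exact hα (by rw [coeff_component]; exact if_neg h)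

/-- The homogeneous series of all weights span the graded ring. -/
theorem gr_eq_span (u : Fin n → ℝ) :
    Subalgebra.toSubmodule (gr K u) = Submodule.span K (⋃ k, homogeneous u k) := by
  apply le_antisymm
  · intro f hf
    have hfin : (weights u f).Finite := hf
    have hsum : f = ∑ k ∈ hfin.toFinset, component u k f := by
      ext α
      rw [map_sum]
      simp only [coeff_component, Finset.sum_ite_eq]
      split_ifs with h
      · rfl
      · by_contra hne
        exact h (hfin.mem_toFinset.mpr ⟨α, hne, rfl⟩)
    rw [hsum]
    refine Submodule.sum_mem _ fun k _ => Submodule.subset_span (Set.mem_iUnion.mpr ⟨k, ?_⟩)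
    intro α hα
    by_contra h
    exact hα (by rw [coeff_component, if_neg h])
  · rw [Submodule.span_le]
    intro f hf
    obtain ⟨k, hk⟩ := Set.mem_iUnion.mp hf
    refine (Set.finite_singleton k).subset ?_
    rintro _ ⟨α, hα, rfl⟩
    exact hk α hα

/-- The initial ideal `in_u(I)`: the ideal of `gr^u(K[[x]])` generated by the initial forms of
the elements of `I`. -/
def initialIdeal (u : Fin n → ℝ) (I : Ideal (MvPowerSeries (Fin n) K)) : Ideal (gr K u) :=
  Ideal.span {g | ∃ f ∈ I, (g : MvPowerSeries (Fin n) K) = initialForm u f}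

end LocalGroebner

end

namespace LocalGroebner

open scoped Classical

variable {K : Type*} [Field K] {n : ℕ}

/-! The proof is a compactness argument with ultrafilters in place of a Gröbner fan. Infinitely many
initial ideals would give a sequence of weights with distinct values, hence an ultrafilter `U` on
`Uloc n` along which no value is taken eventually (`finite_image_of_ultrafilter`). But `U` defines
one monomial order `limitKey U`, comparing the germs of `u ↦ -weight u α`, and it is a well-order by
Dickson's lemma. Take a finite standard basis `g i` for it, with leading exponents `m i`. For
`U`-almost all `u`, each `m i` has maximal weight in `g i`, so division bounds the weights of the
quotients and the `initialForm u (g i)` generate `initialIdeal u I` (`exists_division`,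
`initialIdeal_eq_span`). These forms depend only on the zeros of `u` and on which minimal exponents
of `g i` tie with `m i` (`initialForm_congr`): finitely many conditions, each decided by `U`. -/

/-! ### Graded rings and components of products -/

theorem weight_antitone {u : Fin n → ℝ} (hu : u ∈ Uloc n) : Antitone (weight u) := by
  intro α β h
  refine Finset.sum_le_sum fun i _ => ?_
  have h1 : (α i : ℝ) ≤ β i := by exact_mod_cast h i
  exact mul_le_mul_of_nonpos_left h1 (hu i)

/-- A series belongs to the graded ring of a local weight if and only if its exponents are bounded
in the directions of nonzero weight. -/
theorem mem_gr_iff {u : Fin n → ℝ} (hu : u ∈ Uloc n) (f : MvPowerSeries (Fin n) K) :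
    f ∈ gr K u ↔ ∀ i, u i ≠ 0 → ∃ B : ℕ, ∀ α ∈ supp f, α i ≤ B := by
  constructor
  · intro hf i hi
    have hfin : (weights u f).Finite := hf
    obtain ⟨c, hc⟩ := hfin.bddBelow
    have hneg : u i < 0 := lt_of_le_of_ne (hu i) hi
    obtain ⟨B, hB⟩ := exists_nat_ge (c / u i)
    refine ⟨B, fun α hα => ?_⟩
    have h1 : c ≤ weight u α := hc ⟨α, hα, rfl⟩
    have h2 : weight u α ≤ u i * α i := by
      unfold weight
      rw [← Finset.add_sum_erase _ _ (Finset.mem_univ i)]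
      have : ∑ j ∈ Finset.univ.erase i, u j * (α j : ℝ) ≤ 0 :=
        Finset.sum_nonpos fun j _ => mul_nonpos_of_nonpos_of_nonneg (hu j) (Nat.cast_nonneg _)
      linarith
    have h3 : (α i : ℝ) ≤ c / u i := by
      rw [le_div_iff_of_neg hneg]
      linarith
    exact_mod_cast h3.trans hB
  · intro h
    choose! B hB using h
    have hfin : ((fun b : Fin n → ℕ => ∑ i, u i * (b i : ℝ)) '' Set.Iic B).Finite :=
      (Set.finite_Iic B).image _
    refine Set.Finite.subset hfin ?_
    rintro _ ⟨α, hα, rfl⟩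
    -- Truncation changes only coordinates with `u i = 0`, which carry no weight.
    refine ⟨fun i => min (α i) (B i), fun i => min_le_right _ _, ?_⟩
    refine Finset.sum_congr rfl fun i _ => ?_
    by_cases hi : u i = 0
    · simp [hi]
    · simp only [min_eq_left (hB i hi α hα)]

theorem gr_eq_of_zeros_eq {u v : Fin n → ℝ} (hu : u ∈ Uloc n) (hv : v ∈ Uloc n)
    (h : ∀ i, u i = 0 ↔ v i = 0) : gr K u = gr K v := by
  ext f
  rw [mem_gr_iff hu, mem_gr_iff hv]
  simp only [ne_eq, h]

/-- Generators are kept in the ambient ring, so that ideals of a priori different subrings can be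
compared by substitution. -/
theorem sigma_span_congr {A : Type*} [CommRing A] [Algebra K A] {R R' : Subalgebra K A}
    {S S' : Set A} (hR : R = R') (hS : S = S') :
    (⟨R, Ideal.span {g : R | (g : A) ∈ S}⟩ : Σ R : Subalgebra K A, Ideal R) =
      ⟨R', Ideal.span {g : R' | (g : A) ∈ S'}⟩ := by
  subst hR hS
  rfl

/-- With weights at most `a` and `b`, a sum reaches `a + b` only if both bounds are attained. -/
theorem component_add_mul {u : Fin n → ℝ} {a b : ℝ} {q g : MvPowerSeries (Fin n) K}
    (hq : q ∈ filtLE u a) (hg : g ∈ filtLE u b) :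
    component u (a + b) (q * g) = component u a q * component u b g := by
  ext α
  rw [coeff_component, MvPowerSeries.coeff_mul, MvPowerSeries.coeff_mul]
  simp only [coeff_component]
  have hsum : ∀ p ∈ Finset.HasAntidiagonal.antidiagonal α,
      (if weight u p.1 = a then MvPowerSeries.coeff p.1 q else 0) *
        (if weight u p.2 = b then MvPowerSeries.coeff p.2 g else 0) =
      if weight u α = a + b then MvPowerSeries.coeff p.1 q * MvPowerSeries.coeff p.2 g else 0 := by
    intro p hp
    rw [← Finset.HasAntidiagonal.mem_antidiagonal.mp hp, weight_add]
    by_cases h1 : MvPowerSeries.coeff p.1 q = 0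
    · simp [h1]
    by_cases h2 : MvPowerSeries.coeff p.2 g = 0
    · simp [h2]
    have h3 : weight u p.1 ≤ a := hq _ h1
    have h4 : weight u p.2 ≤ b := hg _ h2
    have h5 : weight u p.1 + weight u p.2 = a + b ↔ weight u p.1 = a ∧ weight u p.2 = b := by
      constructor
      · intro h
        constructor <;> linarith
      · rintro ⟨h6, h7⟩
        rw [h6, h7]
    simp only [h5]
    by_cases h6 : weight u p.1 = a <;> by_cases h7 : weight u p.2 = b <;> simp [h6, h7]
  rw [Finset.sum_congr rfl hsum]
  split_ifs <;> simp

theorem component_sum {ι : Type*} (s : Finset ι) (u : Fin n → ℝ) (k : ℝ)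
    (f : ι → MvPowerSeries (Fin n) K) :
    component u k (∑ i ∈ s, f i) = ∑ i ∈ s, component u k (f i) := by
  ext α
  simp only [coeff_component, map_sum]
  split_ifs <;> simp

/-! ### Division and standard bases -/

/-- The exponents of a set that are minimal for divisibility. -/
def minimals (S : Set (Fin n →₀ ℕ)) : Set (Fin n →₀ ℕ) := {α | Minimal (· ∈ S) α}

theorem minimals_finite (S : Set (Fin n →₀ ℕ)) : (minimals S).Finite :=
  WellQuasiOrderedLE.finite_of_isAntichain (setOfPred_minimal_antichain _)

theorem exists_minimals_le {S : Set (Fin n →₀ ℕ)} {α : Fin n →₀ ℕ} (hα : α ∈ S) :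
    ∃ β ∈ minimals S, β ≤ α := by
  obtain ⟨β, h1, h2⟩ := exists_minimal_le_of_wellFoundedLT (· ∈ S) α hα
  exact ⟨β, h2, h1⟩

/-- Division with remainder by series `g i` with leading exponents `m i`, for an arbitrary
monomial well-order, given through an injection `key` into a linear order. The bound holds for
every weight for which the `m i` are exponents of maximal weight. -/
theorem exists_division {Γ : Type*} [LinearOrder Γ] (key : (Fin n →₀ ℕ) → Γ)
    (hinj : Function.Injective key)
    (hadd : ∀ γ α β, key α < key β → key (γ + α) < key (γ + β))
    (hwf : WellFounded fun α β => key α < key β)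
    {ι : Type*} [Fintype ι] (g : ι → MvPowerSeries (Fin n) K) (m : ι → Fin n →₀ ℕ)
    (hm : ∀ i, m i ∈ supp (g i)) (hmin : ∀ i, ∀ δ ∈ supp (g i), key (m i) ≤ key δ)
    (f : MvPowerSeries (Fin n) K) :
    ∃ q : ι → MvPowerSeries (Fin n) K,
      (∀ i β, m i ≤ β → MvPowerSeries.coeff β (f - ∑ i, q i * g i) = 0) ∧
      ∀ u : Fin n → ℝ, (∀ i, ∀ δ ∈ supp (g i), weight u δ ≤ weight u (m i)) →
        ∀ i, ∀ γ ∈ supp (q i), ∃ α ∈ supp f, weight u γ + weight u (m i) ≤ weight u α := by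
  -- Each `β` is assigned to at most one divisor `m i`, leaving a single unknown `Q β` per exponent.
  let pick : (Fin n →₀ ℕ) → Option ι := fun β =>
    if h : ∃ i, m i ≤ β then some h.choose else none
  have pick_le : ∀ {i β}, pick β = some i → m i ≤ β := by
    intro i β h
    simp only [pick] at h
    split_ifs at h with h'
    rw [← Option.some.inj h]
    exact h'.choose_spec
  have pick_some : ∀ {i β}, m i ≤ β → ∃ j, pick β = some j := by
    intro i β h
    exact ⟨_, dif_pos ⟨i, h⟩⟩
  let c : (Fin n →₀ ℕ) → K := fun β =>
    (pick β).elim 0 fun j => (MvPowerSeries.coeff (m j) (g j))⁻¹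
  -- Solves the equation at `β` for `Q β`: the other contributions have smaller key. If no `m i`
  -- divides `β`, then `c β = 0` and `Q β = 0`.
  let F : ∀ β : Fin n →₀ ℕ, (∀ α, key α < key β → K) → K := fun β ih =>
    (MvPowerSeries.coeff β f - ∑ i, ∑ p ∈ Finset.HasAntidiagonal.antidiagonal β,
      if h : key (p.1 + m i) < key β ∧ pick (p.1 + m i) = some i then
        ih (p.1 + m i) h.1 * MvPowerSeries.coeff p.2 (g i) else 0) * c β
  let Q : (Fin n →₀ ℕ) → K := hwf.fix F
  have hQ : ∀ β, Q β = (MvPowerSeries.coeff β f - ∑ i, ∑ p ∈ Finset.HasAntidiagonal.antidiagonal β,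
      if key (p.1 + m i) < key β ∧ pick (p.1 + m i) = some i then
        Q (p.1 + m i) * MvPowerSeries.coeff p.2 (g i) else 0) * c β := by
    intro β
    have := hwf.fix_eq F β
    simpa only [F, dite_eq_ite] using this
  let q : ι → MvPowerSeries (Fin n) K := fun i γ =>
    if pick (γ + m i) = some i then Q (γ + m i) else 0
  have hq : ∀ i γ, MvPowerSeries.coeff γ (q i) =
      if pick (γ + m i) = some i then Q (γ + m i) else 0 := fun _ _ => rfl
  refine ⟨q, ?_, ?_⟩
  · intro i₀ β hβ
    obtain ⟨j, hj⟩ := pick_some hβ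
    have hjβ := pick_le hj
    have hc : c β * MvPowerSeries.coeff (m j) (g j) = 1 := by
      simp only [c, hj, Option.elim]
      exact inv_mul_cancel₀ (hm j)
    -- By minimality of `m i`, `key (p.1 + m i) ≤ key β`, with equality only for `p.2 = m i`; then
    -- `pick` forces `i = j`.
    have hterm : ∀ i, ∀ p ∈ Finset.HasAntidiagonal.antidiagonal β,
        MvPowerSeries.coeff p.1 (q i) * MvPowerSeries.coeff p.2 (g i) =
        (if key (p.1 + m i) < key β ∧ pick (p.1 + m i) = some i then
          Q (p.1 + m i) * MvPowerSeries.coeff p.2 (g i) else 0) +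
        if i = j ∧ p = (β - m j, m j) then Q β * MvPowerSeries.coeff (m j) (g j) else 0 := by
      rintro i ⟨γ, δ⟩ hp
      rw [Finset.HasAntidiagonal.mem_antidiagonal] at hp
      simp only at hp
      rw [hq]
      by_cases h2 : i = j ∧ (γ, δ) = (β - m j, m j)
      · obtain ⟨rfl, h3⟩ := h2
        obtain ⟨rfl, rfl⟩ := Prod.mk.inj h3
        simp [tsub_add_cancel_of_le hjβ, hj]
      · rw [if_neg h2, add_zero]
        by_cases h3 : pick (γ + m i) = some i
        · by_cases h4 : key (γ + m i) < key β
          · simp [h3, h4]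
          · simp only [h3, h4, false_and, if_true, if_false]
            by_contra h5
            have hδ : δ ∈ supp (g i) := right_ne_zero_of_mul h5
            rcases (hmin i δ hδ).lt_or_eq with h6 | h6
            · exact h4 (hp ▸ hadd γ _ _ h6)
            · have h7 : m i = δ := hinj h6
              subst h7
              rw [hp, hj] at h3
              have h8 : j = i := Option.some.inj h3
              subst h8
              exact h2 ⟨rfl, by rw [← hp, add_tsub_cancel_right]⟩
        · simp [h3]
    have hsum : ∑ i, ∑ p ∈ Finset.HasAntidiagonal.antidiagonal β,
        (if i = j ∧ p = (β - m j, m j) then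
          Q β * MvPowerSeries.coeff (m j) (g j) else 0) =
        Q β * MvPowerSeries.coeff (m j) (g j) := by
      rw [Finset.sum_eq_single j]
      · rw [Finset.sum_eq_single (β - m j, m j)]
        · simp
        · intro p _ hp
          simp [hp]
        · intro h
          exact absurd (Finset.HasAntidiagonal.mem_antidiagonal.mpr (tsub_add_cancel_of_le hjβ)) h
      · intro i _ hi
        simp [hi]
      · simp
    rw [map_sub, map_sum]
    simp only [MvPowerSeries.coeff_mul]
    rw [Finset.sum_congr rfl fun i _ => Finset.sum_congr rfl (hterm i)]
    simp only [Finset.sum_add_distrib]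
    rw [hsum, hQ β, mul_assoc, hc, mul_one]
    ring
  · intro u hu
    have key_bound : ∀ β, Q β ≠ 0 → ∃ α ∈ supp f, weight u β ≤ weight u α := by
      intro β
      induction β using hwf.induction with
      | _ β ih =>
        intro hβ
        by_cases hf : β ∈ supp f
        · exact ⟨β, hf, le_rfl⟩
        rw [hQ] at hβ
        have hf' : MvPowerSeries.coeff β f = 0 := by simpa [supp] using hf
        have h1 := left_ne_zero_of_mul hβ
        rw [hf', zero_sub, neg_ne_zero] at h1
        obtain ⟨i, _, h2⟩ := Finset.exists_ne_zero_of_sum_ne_zero h1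
        obtain ⟨p, hp, h3⟩ := Finset.exists_ne_zero_of_sum_ne_zero h2
        split_ifs at h3 with h4
        · obtain ⟨α, hα, h5⟩ := ih _ h4.1 (left_ne_zero_of_mul h3)
          refine ⟨α, hα, le_trans ?_ h5⟩
          -- Replacing `p.2` by `m i` cannot lower the weight, so the bound at the smaller key
          -- passes to `β`.
          rw [← Finset.HasAntidiagonal.mem_antidiagonal.mp hp, weight_add, weight_add]
          have := hu i p.2 (right_ne_zero_of_mul h3)
          linarith
        · exact absurd rfl h3
    intro i γ hγ
    have hγ' : MvPowerSeries.coeff γ (q i) ≠ 0 := hγ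
    rw [hq] at hγ'
    split_ifs at hγ' with h
    · rw [← weight_add]
      exact key_bound _ hγ'
    · exact absurd rfl hγ'

/-- Every ideal has a finite standard basis with respect to a monomial well-order. -/
theorem exists_standardBasis {Γ : Type*} [LinearOrder Γ] (key : (Fin n →₀ ℕ) → Γ)
    (hwf : WellFounded fun α β => key α < key β)
    (I : Ideal (MvPowerSeries (Fin n) K)) :
    ∃ (M : Set (Fin n →₀ ℕ)) (_ : M.Finite) (g : M → MvPowerSeries (Fin n) K),
      (∀ i, g i ∈ I) ∧ (∀ i, (i : Fin n →₀ ℕ) ∈ supp (g i)) ∧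
      (∀ i, ∀ δ ∈ supp (g i), key i ≤ key δ) ∧
      ∀ f ∈ I, f ≠ 0 → ∃ α ∈ supp f, ∃ i : M, (i : Fin n →₀ ℕ) ≤ α := by
  let E : Set (Fin n →₀ ℕ) :=
    {α | ∃ f ∈ I, α ∈ supp f ∧ ∀ δ ∈ supp f, key α ≤ key δ}
  have hE : ∀ i : minimals E, ∃ f ∈ I, (i : Fin n →₀ ℕ) ∈ supp f ∧
      ∀ δ ∈ supp f, key i ≤ key δ := fun i => i.2.1
  choose g hgI hg1 hg2 using hE
  refine ⟨minimals E, minimals_finite E, g, hgI, hg1, hg2, fun f hf hf0 => ?_⟩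
  have hne := supp_nonempty hf0
  have hα : hwf.min (supp f) hne ∈ E :=
    ⟨f, hf, hwf.min_mem _ hne, fun δ hδ => not_lt.mp (hwf.not_lt_min _ hδ)⟩
  obtain ⟨β, hβ, hle⟩ := exists_minimals_le hα
  exact ⟨_, hwf.min_mem _ hne, ⟨β, hβ⟩, hle⟩

/-! ### Generators of the initial ideal -/

theorem ord_eq_of_max {u : Fin n → ℝ} {g : MvPowerSeries (Fin n) K} {m : Fin n →₀ ℕ}
    (hm : m ∈ supp g) (hmax : ∀ δ ∈ supp g, weight u δ ≤ weight u m) :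
    ord u g = weight u m := by
  refine IsGreatest.csSup_eq ⟨⟨m, hm, rfl⟩, ?_⟩
  rintro _ ⟨δ, hδ, rfl⟩
  exact hmax δ hδ

/-- No `q i * g i` exceeds the order of `f`, so the component of that weight expresses the initial
form of `f` through those of the `g i`. -/
theorem initialIdeal_eq_span {u : Fin n → ℝ} (hu : u ∈ Uloc n)
    {I : Ideal (MvPowerSeries (Fin n) K)} {ι : Type*} [Fintype ι]
    {g : ι → MvPowerSeries (Fin n) K} (hgI : ∀ i, g i ∈ I)
    (h : ∀ f ∈ I, ∃ q : ι → MvPowerSeries (Fin n) K, f = ∑ i, q i * g i ∧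
      ∀ i, ∀ γ ∈ supp (q i), ∃ α ∈ supp f, weight u γ + ord u (g i) ≤ weight u α) :
    initialIdeal u I = Ideal.span {x : gr K u |
      (x : MvPowerSeries (Fin n) K) ∈ Set.range fun i => initialForm u (g i)} := by
  apply le_antisymm
  · refine Ideal.span_le.mpr ?_
    rintro x ⟨f, hf, hx⟩
    by_cases hf0 : f = 0
    · have : x = 0 := by
        apply Subtype.ext
        rw [hx, hf0]
        ext α
        simp [initialForm, coeff_component]
      rw [this]
      exact zero_mem _
    obtain ⟨q, hfq, hq⟩ := h f hf
    have hg : ∀ i, g i ∈ filtLE u (ord u (g i)) := by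
      intro i α hα
      have hne : g i ≠ 0 := by
        rintro h0
        simp [h0, supp] at hα
      exact (isGreatest_ord hu hne).2 ⟨α, hα, rfl⟩
    have hx' : x = ∑ i, (⟨component u (ord u f - ord u (g i)) (q i), component_mem_gr _ _ _⟩ :
        gr K u) * ⟨initialForm u (g i), component_mem_gr _ _ _⟩ := by
      apply Subtype.ext
      rw [hx]
      push_cast
      conv_lhs => rw [initialForm]
      conv_lhs => rw [show component u (ord u f) f = component u (ord u f) (∑ i, q i * g i) by
        rw [← hfq]]
      rw [component_sum]
      refine Finset.sum_congr rfl fun i _ => ?_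
      rw [initialForm, ← component_add_mul _ (hg i), sub_add_cancel]
      intro γ hγ
      obtain ⟨α, hα, hle⟩ := hq i γ hγ
      have := (isGreatest_ord hu hf0).2 ⟨α, hα, rfl⟩
      linarith
    rw [hx']
    exact Ideal.sum_mem _ fun i _ => Ideal.mul_mem_left _ _ (Ideal.subset_span ⟨i, rfl⟩)
  · refine Ideal.span_mono ?_
    rintro x ⟨i, hi⟩
    exact ⟨g i, hgI i, hi.symm⟩

/-- The weight cannot increase from `m` to `δ₀` nor from `δ₀` to `δ`; the total drop vanishes only
if both do. -/
theorem weight_eq_iff_of_le {u : Fin n → ℝ} (hu : u ∈ Uloc n) {δ₀ δ m : Fin n →₀ ℕ}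
    (hle : δ₀ ≤ δ) (hm : weight u δ₀ ≤ weight u m) :
    weight u δ = weight u m ↔
      weight u δ₀ = weight u m ∧ ∀ i, u i = 0 ∨ (δ - δ₀) i = 0 := by
  have h1 : weight u δ = weight u (δ - δ₀) + weight u δ₀ := by
    rw [← weight_add, tsub_add_cancel_of_le hle]
  have hnp : ∀ i ∈ Finset.univ, u i * ((δ - δ₀) i : ℝ) ≤ 0 := fun i _ =>
    mul_nonpos_of_nonpos_of_nonneg (hu i) (Nat.cast_nonneg _)
  have h2 : weight u (δ - δ₀) ≤ 0 := Finset.sum_nonpos hnp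
  have h3 : weight u (δ - δ₀) = 0 ↔ ∀ i, u i = 0 ∨ (δ - δ₀) i = 0 := by
    unfold weight
    rw [Finset.sum_eq_zero_iff_of_nonpos hnp]
    simp only [Finset.mem_univ, true_imp_iff, mul_eq_zero, Nat.cast_eq_zero]
  rw [← h3]
  constructor
  · intro h
    constructor <;> linarith
  · rintro ⟨h4, h5⟩
    linarith

/-- Every exponent lies above a minimal one, so finitely many ties and the zeros of the weight
determine the whole form. -/
theorem initialForm_congr {u v : Fin n → ℝ} (hu : u ∈ Uloc n) (hv : v ∈ Uloc n)
    (h0 : ∀ i, u i = 0 ↔ v i = 0) {g : MvPowerSeries (Fin n) K} {m : Fin n →₀ ℕ}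
    (hm : m ∈ supp g) (humax : ∀ δ ∈ supp g, weight u δ ≤ weight u m)
    (hvmax : ∀ δ ∈ supp g, weight v δ ≤ weight v m)
    (h : ∀ δ ∈ minimals (supp g), weight u δ = weight u m ↔ weight v δ = weight v m) :
    initialForm u g = initialForm v g := by
  ext α
  rw [initialForm, initialForm, coeff_component, coeff_component, ord_eq_of_max hm humax,
    ord_eq_of_max hm hvmax]
  by_cases hα : α ∈ supp g
  · obtain ⟨β, hβ, hle⟩ := exists_minimals_le hα
    simp only [weight_eq_iff_of_le hu hle (humax β hβ.1),
      weight_eq_iff_of_le hv hle (hvmax β hβ.1), h β hβ, h0]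
  · have : MvPowerSeries.coeff α g = 0 := by simpa [supp] using hα
    simp [this]

/-! ### The monomial order of an ultrafilter -/

/-- The exponents ordered by the limit along an ultrafilter of the weights, ties being broken
lexicographically. -/
def limitKey (U : Ultrafilter (Fin n → ℝ)) (α : Fin n →₀ ℕ) :
    Filter.Germ (U : Filter (Fin n → ℝ)) ℝ ×ₗ Lex (Fin n →₀ ℕ) :=
  toLex (((fun u => -weight u α : (Fin n → ℝ) → ℝ) :
    Filter.Germ (U : Filter (Fin n → ℝ)) ℝ), toLex α)

theorem limitKey_injective (U : Ultrafilter (Fin n → ℝ)) : Function.Injective (limitKey U) := by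
  intro α β h
  exact congrArg (fun x => ofLex (ofLex x).2) h

theorem limitKey_add_lt (U : Ultrafilter (Fin n → ℝ)) (γ α β : Fin n →₀ ℕ)
    (h : limitKey U α < limitKey U β) : limitKey U (γ + α) < limitKey U (γ + β) := by
  have hW : ∀ δ : Fin n →₀ ℕ, ((fun u => -weight u (γ + δ) : (Fin n → ℝ) → ℝ) :
      Filter.Germ (U : Filter (Fin n → ℝ)) ℝ) =
      ((fun u => -weight u γ : (Fin n → ℝ) → ℝ) : Filter.Germ (U : Filter (Fin n → ℝ)) ℝ) +
      ((fun u => -weight u δ : (Fin n → ℝ) → ℝ) : Filter.Germ (U : Filter (Fin n → ℝ)) ℝ) := by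
    intro δ
    rw [← Filter.Germ.coe_add]
    congr 1
    funext u
    simp only [Pi.add_apply, weight_add, neg_add]
  simp only [limitKey, Prod.Lex.toLex_lt_toLex, hW, toLex_add, add_lt_add_iff_left,
    add_right_inj] at h ⊢
  exact h

theorem limitKey_monotone {U : Ultrafilter (Fin n → ℝ)} (hU : ∀ᶠ u in U, u ∈ Uloc n) :
    Monotone (limitKey U) := by
  intro α β h
  have h1 : ((fun u => -weight u α : (Fin n → ℝ) → ℝ) : Filter.Germ (U : Filter (Fin n → ℝ)) ℝ) ≤
      ((fun u => -weight u β : (Fin n → ℝ) → ℝ) : Filter.Germ (U : Filter (Fin n → ℝ)) ℝ) := by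
    rw [Filter.Germ.coe_le]
    filter_upwards [hU] with u hu
    exact neg_le_neg (weight_antitone hu h)
  rw [limitKey, limitKey, Prod.Lex.toLex_le_toLex]
  rcases h1.lt_or_eq with h2 | h2
  · exact Or.inl h2
  · exact Or.inr ⟨h2, Finsupp.toLex_monotone h⟩

/-- The germs are not well-ordered, but a monotone image of a set of exponents is, by Dickson's
lemma. -/
theorem limitKey_wellFounded {U : Ultrafilter (Fin n → ℝ)} (hU : ∀ᶠ u in U, u ∈ Uloc n) :
    WellFounded fun α β => limitKey U α < limitKey U β := by
  rw [WellFounded.wellFounded_iff_has_min]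
  intro S hS
  have hwf : (limitKey U '' S).IsWF :=
    ((Set.isPWO_of_wellQuasiOrderedLE S).image_of_monotone (limitKey_monotone hU)).isWF
  obtain ⟨α, hα, hα'⟩ := hwf.min_mem (hS.image _)
  refine ⟨α, hα, fun β hβ hlt => ?_⟩
  have := hwf.min_le (hS.image _) ⟨β, hβ, rfl⟩
  rw [← hα'] at this
  exact absurd hlt (not_lt.mpr this)

theorem eventually_weight_le {U : Ultrafilter (Fin n → ℝ)} {α β : Fin n →₀ ℕ}
    (h : limitKey U α ≤ limitKey U β) : ∀ᶠ u in U, weight u β ≤ weight u α := by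
  have h1 : ((fun u => -weight u α : (Fin n → ℝ) → ℝ) : Filter.Germ (U : Filter (Fin n → ℝ)) ℝ) ≤
      ((fun u => -weight u β : (Fin n → ℝ) → ℝ) : Filter.Germ (U : Filter (Fin n → ℝ)) ℝ) := by
    rw [limitKey, limitKey, Prod.Lex.toLex_le_toLex] at h
    rcases h with h | h
    · exact h.le
    · exact h.1.le
  rw [Filter.Germ.coe_le] at h1
  filter_upwards [h1] with u hu
  exact neg_le_neg_iff.mp hu

/-! ### Constancy along ultrafilters and finiteness -/

theorem eventually_iff_eventually {X : Type*} (U : Ultrafilter X) (p : X → Prop) :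
    ∀ᶠ x in U, (p x ↔ ∀ᶠ y in U, p y) := by
  by_cases h : ∀ᶠ y in U, p y
  · filter_upwards [h] with x hx
    exact iff_of_true hx h
  · filter_upwards [Ultrafilter.eventually_not.mpr h] with x hx
    exact iff_of_false hx h

/-- The graded ring together with the initial ideal is constant along an ultrafilter of local
weights. -/
theorem exists_eventually_initialIdeal_eq (I : Ideal (MvPowerSeries (Fin n) K))
    (U : Ultrafilter (Fin n → ℝ)) (hU : ∀ᶠ u in U, u ∈ Uloc n) :
    ∃ s : Σ R : Subalgebra K (MvPowerSeries (Fin n) K), Ideal R,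
      ∀ᶠ u in U, (⟨gr K u, initialIdeal u I⟩ :
        Σ R : Subalgebra K (MvPowerSeries (Fin n) K), Ideal R) = s := by
  have hwf := limitKey_wellFounded hU
  obtain ⟨M, hM, g, hgI, hg, hgmin, hbasis⟩ := exists_standardBasis (limitKey U) hwf I
  have : Fintype M := hM.fintype
  -- Restricting to minimal exponents makes this a finite conjunction, which commutes with `∀ᶠ`.
  have hmax : ∀ᶠ u in U, ∀ i : M, ∀ δ ∈ minimals (supp (g i)), weight u δ ≤ weight u i := by
    rw [Filter.eventually_all]
    intro i
    rw [(minimals_finite _).eventually_all]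
    exact fun δ hδ => eventually_weight_le (hgmin i δ hδ.1)
  have hzero := Filter.eventually_all.mpr fun i : Fin n =>
    eventually_iff_eventually U fun u : Fin n → ℝ => u i = 0
  have hface : ∀ᶠ u in U, ∀ i : M, ∀ δ ∈ minimals (supp (g i)),
      (weight u δ = weight u i ↔ ∀ᶠ v in U, weight v δ = weight v i) := by
    rw [Filter.eventually_all]
    intro i
    rw [(minimals_finite _).eventually_all]
    exact fun δ _ => eventually_iff_eventually U fun u => weight u δ = weight u i
  have hgood : ∀ᶠ u in U, u ∈ Uloc n ∧
      (∀ i : M, ∀ δ ∈ supp (g i), weight u δ ≤ weight u i) ∧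
      (∀ i, u i = 0 ↔ ∀ᶠ v : Fin n → ℝ in U, v i = 0) ∧
      ∀ i : M, ∀ δ ∈ minimals (supp (g i)),
        (weight u δ = weight u i ↔ ∀ᶠ v in U, weight v δ = weight v i) := by
    filter_upwards [hU, hmax, hzero, hface] with u h1 h2 h3 h4
    refine ⟨h1, fun i δ hδ => ?_, h3, h4⟩
    obtain ⟨δ₀, hδ₀, hle⟩ := exists_minimals_le hδ
    exact (weight_antitone h1 hle).trans (h2 i δ₀ hδ₀)
  have hspan : ∀ u ∈ Uloc n, (∀ i : M, ∀ δ ∈ supp (g i), weight u δ ≤ weight u i) →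
      initialIdeal u I = Ideal.span {x : gr K u |
        (x : MvPowerSeries (Fin n) K) ∈ Set.range fun i => initialForm u (g i)} := by
    intro u hu hle
    refine initialIdeal_eq_span hu hgI fun f hf => ?_
    obtain ⟨q, hq1, hq2⟩ := exists_division (limitKey U) (limitKey_injective U)
      (limitKey_add_lt U) hwf g (fun i => i) hg hgmin f
    refine ⟨q, ?_, fun i γ hγ => ?_⟩
    -- The remainder lies in `I` but has no exponent divisible by an `i : M`, so it is zero.
    · by_contra hne
      obtain ⟨α, hα, i, hi⟩ := hbasis (f - ∑ i, q i * g i)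
        (I.sub_mem hf (I.sum_mem fun i _ => I.mul_mem_left _ (hgI i))) (sub_ne_zero.mpr hne)
      exact hα (hq1 i α hi)
    · rw [ord_eq_of_max (hg i) (hle i)]
      exact hq2 u hle i γ hγ
  obtain ⟨v, hv, hvmax, hv0, hvf⟩ := hgood.exists
  refine ⟨⟨gr K v, initialIdeal v I⟩, ?_⟩
  filter_upwards [hgood] with u ⟨hu, humax, hu0, huf⟩
  rw [hspan u hu humax, hspan v hv hvmax]
  have h0 : ∀ i, u i = 0 ↔ v i = 0 := fun i => (hu0 i).trans (hv0 i).symm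
  refine sigma_span_congr (gr_eq_of_zeros_eq hu hv h0) (congrArg Set.range (funext fun i => ?_))
  exact initialForm_congr hu hv h0 (hg i) (humax i) (hvmax i) fun δ hδ =>
    (huf i δ hδ).trans (hvf i δ hδ).symm

/-- Push a nonprincipal ultrafilter on `ℕ` forward along points with distinct values: each value is
taken at most once, hence not eventually. -/
theorem finite_image_of_ultrafilter {X Y : Type*} (F : X → Y) (S : Set X)
    (h : ∀ U : Ultrafilter X, (∀ᶠ x in U, x ∈ S) → ∃ y, ∀ᶠ x in U, F x = y) :
    (F '' S).Finite := by
  by_contra hinf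
  let e := Set.Infinite.natEmbedding _ hinf
  choose x hxS hx using fun k => (e k).2
  obtain ⟨y, hy⟩ := h ((Filter.hyperfilter ℕ).map x) 
    (Filter.Eventually.of_forall (f := (Filter.hyperfilter ℕ : Filter ℕ)) hxS)
  have hfin : {k | F (x k) = y}.Finite := by
    refine Set.Subsingleton.finite fun k hk l hl => e.injective (Subtype.ext ?_)
    rw [← hx, ← hx]
    exact Eq.trans hk (Eq.symm hl)
  exact Filter.notMem_hyperfilter_of_finite hfin hy

end LocalGroebner

theorem mainTheorem4 {K : Type*} [Field K] (n : ℕ)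
    (I : Ideal (MvPowerSeries (Fin n) K)) :
    ((fun u : Fin n → ℝ =>
        (⟨LocalGroebner.gr K u, LocalGroebner.initialIdeal u I⟩ :
          Σ R : Subalgebra K (MvPowerSeries (Fin n) K), Ideal R)) ''
      LocalGroebner.Uloc n).Finite :=
  LocalGroebner.finite_image_of_ultrafilter _ _
    (LocalGroebner.exists_eventually_initialIdeal_eq I)
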